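/- A $(\mathsf K,\mathsf N,\mathsf N_{\rm r},\mathsf K_{\rm c},\mathsf M)$ distributed linearly separable computation problem is the following. A master and $\mathsf N$ workers know a matrix $\mathbf F\in\mathbb F_{\mathsf q}^{\mathsf K_{\rm c}\times\mathsf K}$; there are $\mathsf K$ messages $W_1,\dots,W_{\mathsf K}\in\mathbb F_{\mathsf q}^{\mathsf L}$; all entries of $\mathbf F$ and of the messages are independent and uniform over $\mathbb F_{\mathsf q}$. A computation scheme, with message length $\mathsf L\ge 1$ and answer lengths $\mathsf T_1,\dots,\mathsf T_{\mathsf N}\in\mathbb{Z}_{\ge 0}$ not depending on $\mathsf q$, consists, for each prime power $\mathsf q$, of: assignments $\mathcal Z_n=\varphi_n(\mathbf F)\subseteq[\mathsf K]$ with $|\mathcal Z_n|\le\mathsf M$ for each worker $n$; answers $X_n=\psi_n((W_k)_{k\in\mathcal Z_n},\mathbf F)\in\mathbb F_{\mathsf q}^{\mathsf T_n}$; and, for each $\mathcal A\subseteq[\mathsf N]$ with $|\mathcal A|=\mathsf N_{\rm r}$, a decoding function $\phi_{\mathcal A}$. Its error probability is $\varepsilon=\max_{|\mathcal A|=\mathsf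 N_{\rm r}}\Pr\{\phi_{\mathcal A}((X_n)_{n\in\mathcal A},\mathbf F)\ne\mathbf F[W_1;\dots;W_{\mathsf K}]\}$ and its communication cost is $\mathsf R=\max_{|\mathcal A|=\mathsf N_{\rm r}}\sum_{n\in\mathcal A}\mathsf T_n/\mathsf L$. The cost $\mathsf R$ is achievable if some scheme of cost $\mathsf R$ has $\varepsilon\to 0$ as $\mathsf q\to\infty$. Let $\mathsf C$ be the minimum achievable communication cost (over all $\mathsf L$ and all schemes). Let $\mathsf N$ divide $\mathsf K$, let $1\le\mathsf N_{\rm r}\le\mathsf N$ and $1\le\mathsf K_{\rm c}\le\mathsf K$, and let the computation cost be minimum, $\mathsf M=\frac{\mathsf K}{\mathsf N}(\mathsf N-\mathsf N_{\rm r}+1)$. Then the minimum $\mathsf C$ is attained in each of the following cases, and its value is: - if $\mathsf N_{\rm r}=1$: $\mathsf C=\mathsf K_{\rm c}$; - if $\mathsf N_{\rm r}=2$: $\mathsf C=2\mathsf K_{\rm c}$ when $\mathsf K_{\rm c}\le\frac{\mathsf K}{\mathsf N}$; $\mathsf C=2\frac{\mathsf K}{\mathsf N}$ when $\frac{\mathsf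 K}{\mathsf N}<\mathsf K_{\rm c}\le 2\frac{\mathsf K}{\mathsf N}$; $\mathsf C=\mathsf K_{\rm c}$ when $2\frac{\mathsf K}{\mathsf N}<\mathsf K_{\rm c}\le\mathsf K$; - if $\mathsf N_{\rm r}=\mathsf N$: $\mathsf C=\mathsf N\mathsf K_{\rm c}$ when $\mathsf K_{\rm c}\le\frac{\mathsf K}{\mathsf N}$; $\mathsf C=\mathsf K$ when $\frac{\mathsf K}{\mathsf N}<\mathsf K_{\rm c}\le\mathsf K$. -/

import Mathlib

namespace DistSepComp

/-- A computation scheme over the finite field `𝔽` for `K` messages of `L` symbols each, `N` workers,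
`Nr` responding workers, `Kc` requested linear combinations and computation cost `M`; worker `n`
sends `T n` symbols. The request matrix `G` is known to the workers and to the master, so the
assignment, the encoding functions and the decoding functions may all depend on it. -/
structure Scheme (𝔽 : Type) (K N Nr Kc M L : ℕ) (T : Fin N → ℕ) where
  /-- The set of datasets assigned to worker `n` when the request matrix is `G`. -/
  assign : Matrix (Fin Kc) (Fin K) 𝔽 → Fin N → Finset (Fin K)
  /-- No worker is assigned more than `M` datasets. -/
  card_assign_le : ∀ G n, (assign G n).card ≤ M
  /-- The encoding function of worker `n`: it sees only the messages of its assigned datasets. -/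
  encode : (G : Matrix (Fin Kc) (Fin K) 𝔽) → (n : Fin N) →
    (↥(assign G n) → Fin L → 𝔽) → (Fin (T n) → 𝔽)
  /-- The decoding function of the master for the set `A` of responding workers. -/
  decode : (G : Matrix (Fin Kc) (Fin K) 𝔽) → (A : {A : Finset (Fin N) // A.card = Nr}) →
    ((n : ↥A.1) → Fin (T n.1) → 𝔽) → Matrix (Fin Kc) (Fin L) 𝔽

namespace Scheme

variable {𝔽 : Type} {K N Nr Kc M L : ℕ} {T : Fin N → ℕ}

/-- The answer of worker `n`, for the request matrix `G` and the messages `W` (row `k` of `W` is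
the `k`-th message). -/
def answer (S : Scheme 𝔽 K N Nr Kc M L T) (G : Matrix (Fin Kc) (Fin K) 𝔽)
    (W : Matrix (Fin K) (Fin L) 𝔽) (n : Fin N) : Fin (T n) → 𝔽 :=
  S.encode G n (fun k => W k.1)

/-- What the master computes from the answers of the workers in `A`. -/
def output (S : Scheme 𝔽 K N Nr Kc M L T) (G : Matrix (Fin Kc) (Fin K) 𝔽)
    (W : Matrix (Fin K) (Fin L) 𝔽) (A : {A : Finset (Fin N) // A.card = Nr}) :
    Matrix (Fin Kc) (Fin L) 𝔽 :=
  S.decode G A (fun n => S.answer G W n.1)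

open Classical in
/-- The probability that the master fails to recover `G * W` from the answers of the workers in
`A`, when all entries of the request matrix `G` and of the messages `W` are independent and
uniformly distributed over `𝔽`. -/
noncomputable def errorProb [Field 𝔽] [Fintype 𝔽] (S : Scheme 𝔽 K N Nr Kc M L T)
    (A : {A : Finset (Fin N) // A.card = Nr}) : ℝ :=
  ((Finset.univ.filter
      (fun p : Matrix (Fin Kc) (Fin K) 𝔽 × Matrix (Fin K) (Fin L) 𝔽 =>
        S.output p.1 p.2 A ≠ p.1 * p.2)).card : ℝ) /
    (Fintype.card (Matrix (Fin Kc) (Fin K) 𝔽 × Matrix (Fin K) (Fin L) 𝔽) : ℝ)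

/-- The worst-case probability of error over all sets of `Nr` responding workers. -/
noncomputable def worstErrorProb [Field 𝔽] [Fintype 𝔽] (S : Scheme 𝔽 K N Nr Kc M L T) : ℝ :=
  ⨆ A : {A : Finset (Fin N) // A.card = Nr}, S.errorProb A

end Scheme

/-- The communication cost: the maximum over all sets of `Nr` responding workers of the number of
symbols they send, normalized by the message length `L`. -/
noncomputable def commCost {N : ℕ} (Nr L : ℕ) (T : Fin N → ℕ) : ℝ :=
  ⨆ A : {A : Finset (Fin N) // A.card = Nr}, (∑ n ∈ A.1, (T n : ℝ)) / (L : ℝ)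

/-- `R` is an achievable communication cost: for some message length `L ≥ 1` and some answer lengths
`T` of communication cost `R` there are computation schemes, one over each finite field, whose
worst-case probability of error tends to `0` as the order of the field tends to infinity. -/
def IsAchievable (K N Nr Kc M : ℕ) (R : ℝ) : Prop :=
  ∃ (L : ℕ) (T : Fin N → ℕ)
    (S : ∀ (𝔽 : Type) [Field 𝔽] [Fintype 𝔽], Scheme 𝔽 K N Nr Kc M L T),
    1 ≤ L ∧ commCost Nr L T = R ∧
    ∀ δ : ℝ, 0 < δ → ∃ q₀ : ℕ, ∀ (𝔽 : Type) [Field 𝔽] [Fintype 𝔽],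
      q₀ ≤ Fintype.card 𝔽 → (S 𝔽).worstErrorProb < δ

/-- `C` is the minimum communication cost over all achievable computation schemes. -/
def IsMinCommCost (K N Nr Kc M : ℕ) (C : ℝ) : Prop :=
  IsLeast {R : ℝ | IsAchievable K N Nr Kc M R} C

end DistSepComp

/-! Write `K = N * m`. The lower bounds are cut-set bounds, valid for arbitrary encoders. Let `s ≤
Kc` datasets be unseen by the responding workers outside a set `S`. A generic request matrix is
injective on vectors supported on those datasets, so once the other messages are fixed, the answers
of `S` must distinguish `q ^ (s * L)` possibilities (`card_decodable_mul_le`). With fewer symbols,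
almost every message matrix is decoded wrongly. Taking `S` to be one worker gives `Nr * s`, and
taking all responding workers gives `Kc`. At minimum computation cost with `Nr = 2` or `Nr = N`, any
`Nr - 1` workers miss at least `m` datasets, so `s = min Kc m` is allowed.

For the upper bounds, the only delicate case is `Nr = 2`, where worker `n` misses exactly group `n`.
Small requests use scalar weights that vanish on the missing group (`computable_two_weighted`).
Otherwise take `L = 2` and a request with `d ≥ 2 * m` rows: worker `n` sends the request modulo a
`d`-dimensional subspace of the `2 * d`-dimensional space, chosen to contain every contribution of
group `n`. These subspaces meet pairwise in zero, so any two answers determine the request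
(`computable_two_projection`), at cost `d`. -/

/-! ### Subspaces over large finite fields -/

open Module in
/-- A finite vector space is not covered by few proper subspaces. -/
theorem exists_forall_notMem_of_ne_top {F V ι : Type*} [Field F] [Fintype F] [AddCommGroup V]
    [Module F V] [FiniteDimensional F V] (s : Finset ι) (p : ι → Submodule F V)
    (hp : ∀ i ∈ s, p i ≠ ⊤) (hs : s.card < Fintype.card F) :
    ∃ v : V, ∀ i ∈ s, v ∉ p i := by
  classical
  by_contra! hcov
  have : Finite V := Module.finite_of_finite F
  have := Fintype.ofFinite V
  have hsub : (Finset.univ : Finset V) ⊆ s.biUnion fun i => (p i : Set V).toFinset := by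
    intro v _
    obtain ⟨i, hi, hv⟩ := hcov v
    exact Finset.mem_biUnion.2 ⟨i, hi, by simpa using hv⟩
  have hcard : ∀ i ∈ s, ((p i : Set V).toFinset).card * Fintype.card F ≤ Fintype.card V := by
    intro i hi
    rw [Set.toFinset_card]
    change Fintype.card (p i) * _ ≤ _
    rw [Module.card_eq_pow_finrank (K := F) (V := p i),
      Module.card_eq_pow_finrank (K := F) (V := V), ← pow_succ]
    exact Nat.pow_le_pow_right Fintype.card_pos (Submodule.finrank_lt (hp i hi))
  have h1 : Fintype.card V * Fintype.card F ≤ s.card * Fintype.card V := by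
    calc Fintype.card V * Fintype.card F
        ≤ (∑ i ∈ s, ((p i : Set V).toFinset).card) * Fintype.card F :=
          Nat.mul_le_mul_right _ ((Finset.card_le_card hsub).trans Finset.card_biUnion_le)
      _ = ∑ i ∈ s, ((p i : Set V).toFinset).card * Fintype.card F := Finset.sum_mul ..
      _ ≤ ∑ _i ∈ s, Fintype.card V := Finset.sum_le_sum hcard
      _ = s.card * Fintype.card V := by simp
  have h2 : 0 < Fintype.card V := Fintype.card_pos
  nlinarith

open Module in
/-- Over a large field, pairwise disjoint subspaces of dimension at most `d` of a space of dimension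
`2 * d` can be enlarged to pairwise disjoint subspaces of dimension `d`. -/
theorem exists_pairwise_disjoint_finrank_eq {F V ι : Type*} [Field F] [Fintype F] [AddCommGroup V]
    [Module F V] [FiniteDimensional F V] [Fintype ι] (d : ℕ) (hV : finrank F V = 2 * d)
    (hq : Fintype.card ι < Fintype.card F) (P : ι → Submodule F V)
    (hP : Pairwise fun a b => Disjoint (P a) (P b)) (hd : ∀ i, finrank F (P i) ≤ d) :
    ∃ Q : ι → Submodule F V, (∀ i, P i ≤ Q i) ∧ (Pairwise fun a b => Disjoint (Q a) (Q b)) ∧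
      ∀ i, finrank F (Q i) = d := by
  classical
  -- Induction on the total missing dimension: each step adds one vector to one deficient subspace.
  induction hn : ∑ i, (d - finrank F (P i)) using Nat.strong_induction_on generalizing P with
  | _ n ih =>
  by_cases hall : ∀ i, finrank F (P i) = d
  · exact ⟨P, fun _ => le_rfl, hP, hall⟩
  push Not at hall
  obtain ⟨a, ha⟩ := hall
  have ha' : finrank F (P a) < d := lt_of_le_of_ne (hd a) ha
  -- Each `P a ⊔ P b` has dimension below `d + d`, hence is proper. The index `b = a` is included,
  -- which also gives `v ∉ P a`.
  obtain ⟨v, hv⟩ := exists_forall_notMem_of_ne_top Finset.univ (fun b => P a ⊔ P b)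
    (fun b _ htop => by
      have h1 := Submodule.finrank_add_le_finrank_add_finrank (P a) (P b)
      have h2 := hd b
      rw [htop, finrank_top] at h1
      omega) hq
  have hva : v ∉ P a := fun h => hv a (Finset.mem_univ a) (Submodule.mem_sup_left h)
  have hdis : ∀ b, b ≠ a → Disjoint (P a ⊔ F ∙ v) (P b) := by
    intro b hb
    rw [Submodule.disjoint_def]
    intro x hx hxb
    obtain ⟨y, hy, z, hz, rfl⟩ := Submodule.mem_sup.1 hx
    obtain ⟨c, rfl⟩ := Submodule.mem_span_singleton.1 hz
    by_cases hc : c = 0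
    · subst hc
      simp only [zero_smul, add_zero] at hxb ⊢
      exact Submodule.disjoint_def.1 (hP hb.symm) y hy hxb
    · refine absurd ?_ (hv b (Finset.mem_univ b))
      have : v = -(c⁻¹ • y) + c⁻¹ • (y + c • v) := by
        rw [smul_add, smul_smul, inv_mul_cancel₀ hc]; simp
      rw [this]
      exact Submodule.add_mem_sup (neg_mem (Submodule.smul_mem _ _ hy)) (Submodule.smul_mem _ _ hxb)
  have hrank : finrank F (P a) < finrank F ↥(P a ⊔ F ∙ v) := by
    refine Submodule.finrank_lt_finrank_of_lt (lt_of_le_of_ne le_sup_left fun h => hva ?_)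
    rw [h]
    exact Submodule.mem_sup_right (Submodule.mem_span_singleton_self v)
  have hrank' : finrank F ↥(P a ⊔ F ∙ v) ≤ d := by
    have h1 := Submodule.finrank_add_le_finrank_add_finrank (P a) (F ∙ v)
    have h2 : finrank F (F ∙ v) ≤ 1 := by
      simpa using finrank_span_le_card (R := F) ({v} : Set V)
    omega
  obtain ⟨Q, hQ, hQd, hQr⟩ := ih (∑ i, (d - finrank F (Function.update P a (P a ⊔ F ∙ v) i)))
    (by
      rw [← hn]
      refine Finset.sum_lt_sum (fun i _ => ?_) ⟨a, Finset.mem_univ _, ?_⟩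
      · by_cases hi : i = a
        · subst hi; rw [Function.update_self]; omega
        · rw [Function.update_of_ne hi]
      · rw [Function.update_self]; omega)
    (Function.update P a (P a ⊔ F ∙ v))
    (by
      intro b c hbc
      by_cases hb : b = a
      · subst hb
        simpa [Function.update_of_ne hbc.symm] using hdis c hbc.symm
      · by_cases hc : c = a
        · subst hc
          simpa [Function.update_of_ne hb] using (hdis b hb).symm
        · simpa [Function.update_of_ne hb, Function.update_of_ne hc] using hP hbc)
    (by
      intro i
      by_cases hi : i = a
      · subst hi; rw [Function.update_self]; exact hrank'
      · rw [Function.update_of_ne hi]; exact hd i) rfl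
  refine ⟨Q, fun i => le_trans ?_ (hQ i), hQd, hQr⟩
  by_cases hi : i = a
  · subst hi; simp
  · simp [Function.update_of_ne hi]

/-! ### Generic request matrices -/

namespace DistSepComp

/-- A matrix is generic when no nonzero vector whose support is at most as large as the number of
rows lies in its kernel. -/
def Generic {F : Type} [Field F] {d K : ℕ} (G : Matrix (Fin d) (Fin K) F) : Prop :=
  ∀ (v : Fin K → F) (D : Finset (Fin K)), D.card ≤ d → (∀ j ∉ D, v j = 0) →
    G.mulVec v = 0 → v = 0

theorem card_matrix_fin (F : Type) [Fintype F] (a b : ℕ) :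
    Fintype.card (Matrix (Fin a) (Fin b) F) = Fintype.card F ^ (a * b) := by
  rw [← Nat.card_eq_fintype_card]
  change Nat.card (Fin a → Fin b → F) = _
  rw [Nat.card_eq_fintype_card]
  simp [← pow_mul, mul_comm]

-- The relation `v k = 1` expresses column `k` through the other columns in `D`. So `G` is
-- determined by the `D.card - 1` free entries of `v` and the `K - 1` other columns; since `D.card ≤
-- d`, a factor `q` is lost.
open Classical in
theorem card_dependent_mul_le {F : Type} [Field F] [Fintype F] {d K : ℕ} (D : Finset (Fin K))
    (k : Fin K) (hk : k ∈ D) (hD : D.card ≤ d) :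
    (Finset.univ.filter fun G : Matrix (Fin d) (Fin K) F =>
      ∃ v : Fin K → F, v k = 1 ∧ (∀ j ∉ D, v j = 0) ∧ G.mulVec v = 0).card * Fintype.card F
      ≤ Fintype.card F ^ (d * K) := by
  set B := Finset.univ.filter fun G : Matrix (Fin d) (Fin K) F =>
      ∃ v : Fin K → F, v k = 1 ∧ (∀ j ∉ D, v j = 0) ∧ G.mulVec v = 0 with hB
  have hex : ∀ G : B, ∃ v : Fin K → F, v k = 1 ∧ (∀ j ∉ D, v j = 0) ∧ G.1.mulVec v = 0 :=
    fun G => (Finset.mem_filter.1 G.2).2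
  choose v hv1 hv2 hv3 using hex
  have hinj : Function.Injective fun G : B =>
      ((fun j => v G j.1, fun i j => G.1 i j.1) :
        (↥(D.erase k) → F) × (Fin d → {j // j ≠ k} → F)) := by
    intro G H h
    simp only [Prod.mk.injEq] at h
    obtain ⟨h1, h2⟩ := h
    have hv : v G = v H := by
      funext j
      by_cases hj : j ∈ D
      · by_cases hjk : j = k
        · rw [hjk, hv1, hv1]
        · exact congrFun h1 ⟨j, Finset.mem_erase.2 ⟨hjk, hj⟩⟩
      · rw [hv2 G j hj, hv2 H j hj]
    have hother : ∀ i j, j ≠ k → G.1 i j = H.1 i j := fun i j hj =>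
      congrFun (congrFun h2 i) ⟨j, hj⟩
    refine Subtype.ext (Matrix.ext fun i j => ?_)
    by_cases hj : j = k
    · subst hj
      have e1 := congrFun (hv3 G) i
      have e2 := congrFun (hv3 H) i
      simp only [Matrix.mulVec, dotProduct, Pi.zero_apply] at e1 e2
      rw [← Finset.add_sum_erase _ _ (Finset.mem_univ j), hv1, mul_one] at e1 e2
      have : ∑ x ∈ Finset.univ.erase j, G.1 i x * v G x =
          ∑ x ∈ Finset.univ.erase j, H.1 i x * v H x :=
        Finset.sum_congr rfl fun x hx => by rw [hother i x (Finset.ne_of_mem_erase hx), hv]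
      rw [this] at e1
      exact add_right_cancel (e1.trans e2.symm)
    · exact hother i j hj
  have hc := Fintype.card_le_of_injective _ hinj
  have hpos : 1 ≤ D.card := Finset.card_pos.2 ⟨k, hk⟩
  have hK : 1 ≤ K := Nat.one_le_of_lt k.2
  simp only [Fintype.card_coe, Fintype.card_prod, Fintype.card_fun, Finset.card_erase_of_mem hk,
    Fintype.card_subtype_compl, Fintype.card_fin, Fintype.card_unique, ← pow_mul] at hc
  calc B.card * Fintype.card F
      ≤ Fintype.card F ^ (D.card - 1) * Fintype.card F ^ ((K - 1) * d) * Fintype.card F :=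
        Nat.mul_le_mul_right _ hc
    _ = Fintype.card F ^ (D.card - 1 + (K - 1) * d + 1) := by rw [pow_succ, pow_add]
    _ ≤ Fintype.card F ^ (d * K) := by
        refine Nat.pow_le_pow_right Fintype.card_pos ?_
        obtain ⟨K', rfl⟩ : ∃ K', K = K' + 1 := ⟨K - 1, by omega⟩
        have : d * (K' + 1) = K' * d + d := by ring
        simp only [Nat.add_sub_cancel]
        omega

open Classical in
/-- Almost all matrices over a large field are generic. -/
theorem card_not_generic_mul_le (F : Type) [Field F] [Fintype F] (d K : ℕ) :
    (Finset.univ.filter fun G : Matrix (Fin d) (Fin K) F => ¬ Generic G).card * Fintype.card F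
      ≤ 2 ^ K * K * Fintype.card F ^ (d * K) := by
  -- Union bound over a support `D` and a coordinate `k` at which the kernel vector can be scaled to
  -- `1`.
  set I : Finset (Finset (Fin K) × Fin K) :=
    Finset.univ.filter fun p => p.2 ∈ p.1 ∧ p.1.card ≤ d with hI
  have hsub : (Finset.univ.filter fun G : Matrix (Fin d) (Fin K) F => ¬ Generic G) ⊆
      I.biUnion fun p => Finset.univ.filter fun G : Matrix (Fin d) (Fin K) F =>
        ∃ v : Fin K → F, v p.2 = 1 ∧ (∀ j ∉ p.1, v j = 0) ∧ G.mulVec v = 0 := by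
    intro G hG
    have hG' := (Finset.mem_filter.1 hG).2
    unfold Generic at hG'
    push Not at hG'
    obtain ⟨v, D, hD, hv, hGv, hne⟩ := hG'
    obtain ⟨k, hk⟩ := Function.ne_iff.1 hne
    have hk' : v k ≠ 0 := hk
    have hkD : k ∈ D := by
      by_contra h
      exact hk' (hv k h)
    refine Finset.mem_biUnion.2 ⟨(D, k), by simp [hI, hkD, hD], ?_⟩
    simp only [Finset.mem_filter, Finset.mem_univ, true_and]
    refine ⟨(v k)⁻¹ • v, ?_, ?_, ?_⟩
    · simp [hk']
    · intro j hj
      simp [hv j hj]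
    · rw [Matrix.mulVec_smul, hGv, smul_zero]
  have hIc : I.card ≤ 2 ^ K * K := by
    refine (Finset.card_le_univ I).trans (le_of_eq ?_)
    simp [Fintype.card_prod]
  calc _ ≤ (∑ p ∈ I, (Finset.univ.filter fun G : Matrix (Fin d) (Fin K) F =>
        ∃ v : Fin K → F, v p.2 = 1 ∧ (∀ j ∉ p.1, v j = 0) ∧ G.mulVec v = 0).card)
          * Fintype.card F :=
        Nat.mul_le_mul_right _ ((Finset.card_le_card hsub).trans Finset.card_biUnion_le)
    _ = ∑ p ∈ I, (Finset.univ.filter fun G : Matrix (Fin d) (Fin K) F =>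
        ∃ v : Fin K → F, v p.2 = 1 ∧ (∀ j ∉ p.1, v j = 0) ∧ G.mulVec v = 0).card
          * Fintype.card F := Finset.sum_mul ..
    _ ≤ ∑ _p ∈ I, Fintype.card F ^ (d * K) := by
        refine Finset.sum_le_sum fun p hp => ?_
        have hp' := (Finset.mem_filter.1 hp).2
        exact card_dependent_mul_le p.1 p.2 hp'.1 hp'.2
    _ = I.card * Fintype.card F ^ (d * K) := by simp
    _ ≤ _ := Nat.mul_le_mul_right _ hIc

/-! ### Cut-set lower bounds -/

open Classical in
/-- For a generic request matrix, a set `S` of responding workers that sends too few symbols about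
the datasets assigned to no other responding worker makes most messages undecodable. -/
theorem card_decodable_mul_le {F : Type} [Field F] [Fintype F] {K N Nr Kc M L : ℕ} {T : Fin N → ℕ}
    (C : Scheme F K N Nr Kc M L T) (G : Matrix (Fin Kc) (Fin K) F) (hG : Generic G)
    (A : {A : Finset (Fin N) // A.card = Nr}) (S : Finset (Fin N)) (s : ℕ)
    (hs : s ≤ Kc) (hsK : s + (A.1 \ S).card * M ≤ K) (hT : ∑ n ∈ S, T n < s * L) :
    (Finset.univ.filter fun W : Matrix (Fin K) (Fin L) F => C.output G W A = G * W).card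
      * Fintype.card F ≤ Fintype.card F ^ (K * L) := by
  set B := Finset.univ.filter fun W : Matrix (Fin K) (Fin L) F => C.output G W A = G * W with hB
  have hU : ((A.1 \ S).biUnion (C.assign G)).card ≤ (A.1 \ S).card * M :=
    Finset.card_biUnion_le_card_mul _ _ _ fun n _ => C.card_assign_le G n
  have hUc := Finset.card_compl ((A.1 \ S).biUnion (C.assign G))
  rw [Fintype.card_fin] at hUc
  obtain ⟨D, hDsub, hDcard⟩ : ∃ D ⊆ ((A.1 \ S).biUnion (C.assign G))ᶜ, D.card = s :=
    Finset.exists_subset_card_eq (by omega)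
  -- `D` is unseen by the workers of `A \ S`, so the messages outside `D` fix their answers.
  -- Together with the answers of `S` this fixes `G * W`, and genericity then recovers the rows in
  -- `D`.
  have hinj : Function.Injective fun W : B =>
      ((fun k l => W.1 k.1 l, fun n t => C.answer G W.1 n.1 t) :
        ({k // k ∉ D} → Fin L → F) × ((n : ↥S) → Fin (T n.1) → F)) := by
    intro W W' h
    simp only [Prod.mk.injEq] at h
    obtain ⟨h1, h2⟩ := h
    have hout : ∀ k, k ∉ D → W.1 k = W'.1 k := fun k hk => congrFun h1 ⟨k, hk⟩
    have hans : ∀ n ∈ A.1, C.answer G W.1 n = C.answer G W'.1 n := by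
      intro n hn
      by_cases hnS : n ∈ S
      · exact congrFun h2 ⟨n, hnS⟩
      · unfold Scheme.answer
        congr 1
        funext k
        refine hout k.1 fun hk => ?_
        exact Finset.mem_compl.1 (hDsub hk)
          (Finset.mem_biUnion.2 ⟨n, Finset.mem_sdiff.2 ⟨hn, hnS⟩, k.2⟩)
    have hdec : C.output G W.1 A = C.output G W'.1 A := by
      unfold Scheme.output
      congr 1
      funext n
      exact hans n.1 n.2
    have hGW : G * W.1 = G * W'.1 := by
      rw [← (Finset.mem_filter.1 W.2).2, ← (Finset.mem_filter.1 W'.2).2, hdec]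
    refine Subtype.ext (Matrix.ext fun k l => ?_)
    have hz := hG (fun k => W.1 k l - W'.1 k l) D (by omega)
      (fun j hj => by rw [hout j hj, sub_self]) (by
        funext i
        have := congrFun (congrFun hGW i) l
        simp only [Matrix.mul_apply] at this
        simp only [Matrix.mulVec, dotProduct, mul_sub, Finset.sum_sub_distrib, this, sub_self,
          Pi.zero_apply])
    exact sub_eq_zero.1 (congrFun hz k)
  have hc := Fintype.card_le_of_injective _ hinj
  have hDK : D.card ≤ K := by simpa using Finset.card_le_univ D
  have hsub : Fintype.card {k // k ∉ D} = K - s := by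
    rw [Fintype.card_subtype_compl, Fintype.card_fin, Fintype.card_coe, hDcard]
  simp only [Fintype.card_coe, Fintype.card_prod, Fintype.card_fun, Fintype.card_pi, hsub,
    Fintype.card_fin, ← pow_mul] at hc
  rw [Finset.prod_coe_sort S (fun n => Fintype.card F ^ T n), Finset.prod_pow_eq_pow_sum,
    ← pow_add] at hc
  refine (Nat.mul_le_mul_right _ hc).trans ?_
  rw [← pow_succ]
  -- The strict inequality in `hT` pays for the extra factor `q`.
  refine Nat.pow_le_pow_right Fintype.card_pos ?_
  obtain ⟨r, rfl⟩ : ∃ r, K = s + r := ⟨K - s, by omega⟩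
  have : (s + r) * L = L * r + s * L := by ring
  rw [Nat.add_sub_cancel_left]
  omega

-- Non-generic request matrices have proportion at most `2 ^ K * K / q`, and a generic one allows at
-- most a `1 / q` fraction of correctly decoded messages.
open Classical in
theorem one_sub_le_errorProb {F : Type} [Field F] [Fintype F] {K N Nr Kc M L : ℕ} {T : Fin N → ℕ}
    (C : Scheme F K N Nr Kc M L T)
    (A : {A : Finset (Fin N) // A.card = Nr}) (S : Finset (Fin N)) (s : ℕ)
    (hs : s ≤ Kc) (hsK : s + (A.1 \ S).card * M ≤ K) (hT : ∑ n ∈ S, T n < s * L) :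
    1 - (2 ^ K * K + 1 : ℝ) / Fintype.card F ≤ C.errorProb A := by
  set q := Fintype.card F with hq
  have hq0 : 0 < q := Fintype.card_pos
  set Ok := Finset.univ.filter
    (fun p : Matrix (Fin Kc) (Fin K) F × Matrix (Fin K) (Fin L) F =>
      C.output p.1 p.2 A = p.1 * p.2) with hOk
  have hOkc : Ok.card = ∑ G : Matrix (Fin Kc) (Fin K) F,
      (Finset.univ.filter fun W : Matrix (Fin K) (Fin L) F => C.output G W A = G * W).card := by
    simp only [hOk, Finset.card_filter]
    rw [Fintype.sum_prod_type]
  have hcW : Fintype.card (Matrix (Fin K) (Fin L) F) = q ^ (K * L) := card_matrix_fin F K L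
  have hcG : Fintype.card (Matrix (Fin Kc) (Fin K) F) = q ^ (Kc * K) := card_matrix_fin F Kc K
  have hbound : Ok.card * q ≤ (2 ^ K * K + 1) * (q ^ (Kc * K) * q ^ (K * L)) := by
    calc Ok.card * q = ∑ G : Matrix (Fin Kc) (Fin K) F,
          (Finset.univ.filter fun W : Matrix (Fin K) (Fin L) F =>
            C.output G W A = G * W).card * q := by rw [hOkc, Finset.sum_mul]
      _ ≤ ∑ G : Matrix (Fin Kc) (Fin K) F,
          ((if ¬ Generic G then 1 else 0) * (q * q ^ (K * L)) + q ^ (K * L)) := by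
          refine Finset.sum_le_sum fun G _ => ?_
          by_cases hG : Generic G
          · simpa [hG] using card_decodable_mul_le C G hG A S s hs hsK hT
          · simp only [hG, not_false_eq_true, if_true, one_mul]
            refine le_trans ?_ (Nat.le_add_right _ _)
            rw [mul_comm]
            refine Nat.mul_le_mul_left _ ?_
            rw [← hcW]
            exact Finset.card_le_univ _
      _ = (Finset.univ.filter fun G : Matrix (Fin Kc) (Fin K) F => ¬ Generic G).card * q
            * q ^ (K * L) + q ^ (Kc * K) * q ^ (K * L) := by
          rw [Finset.sum_add_distrib, ← Finset.sum_mul, ← Finset.card_filter]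
          simp only [Finset.sum_const, Finset.card_univ, hcG, smul_eq_mul]
          ring
      _ ≤ 2 ^ K * K * q ^ (Kc * K) * q ^ (K * L) + q ^ (Kc * K) * q ^ (K * L) := by
          exact Nat.add_le_add_right
            (Nat.mul_le_mul_right _ (card_not_generic_mul_le F Kc K)) _
      _ = _ := by ring
  have hsum := Finset.card_filter_add_card_filter_not
    (s := (Finset.univ : Finset (Matrix (Fin Kc) (Fin K) F × Matrix (Fin K) (Fin L) F)))
    (fun p => C.output p.1 p.2 A = p.1 * p.2)
  rw [Finset.card_univ, Fintype.card_prod, hcG, hcW] at hsum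
  unfold Scheme.errorProb
  rw [Fintype.card_prod, hcG, hcW]
  set X : ℕ := q ^ (Kc * K) * q ^ (K * L) with hX
  have hX0 : 0 < X := by positivity
  rw [le_div_iff₀ (by exact_mod_cast hX0)]
  have hsum' : (Ok.card : ℝ) + ((Finset.univ.filter
      (fun p : Matrix (Fin Kc) (Fin K) F × Matrix (Fin K) (Fin L) F =>
        C.output p.1 p.2 A ≠ p.1 * p.2)).card : ℝ) = X := by
    exact_mod_cast hsum
  have hb : (Ok.card : ℝ) * q ≤ (2 ^ K * K + 1) * X := by exact_mod_cast hbound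
  have hq0' : (0 : ℝ) < q := by exact_mod_cast hq0
  have hb' : (Ok.card : ℝ) ≤ (2 ^ K * K + 1) / q * X := by
    rw [div_mul_eq_mul_div, le_div_iff₀ hq0']
    exact hb
  rw [sub_mul, one_mul]
  linarith

/-- The cut-set bound: the symbols sent by the workers of `S` must account for the request
restricted to the datasets that the other responding workers do not hold. -/
theorem cutset_bound {K N Nr Kc M L : ℕ} {T : Fin N → ℕ}
    (C : ∀ (F : Type) [Field F] [Fintype F], Scheme F K N Nr Kc M L T)
    (hC : ∀ δ : ℝ, 0 < δ → ∃ q₀ : ℕ, ∀ (F : Type) [Field F] [Fintype F],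
      q₀ ≤ Fintype.card F → (C F).worstErrorProb < δ)
    (A : {A : Finset (Fin N) // A.card = Nr}) (S : Finset (Fin N)) (s : ℕ)
    (hs : s ≤ Kc) (hsK : s + (A.1 \ S).card * M ≤ K) : s * L ≤ ∑ n ∈ S, T n := by
  by_contra! hT
  obtain ⟨q₀, hq₀⟩ := hC (1 / 2) (by norm_num)
  -- Over `ZMod p` with `p` this large, the error is at least `1 / 2`, contradicting `hq₀`.
  obtain ⟨p, hp, hprime⟩ := Nat.exists_infinite_primes (max q₀ (2 * (2 ^ K * K + 1)))
  have : Fact p.Prime := ⟨hprime⟩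
  have h1 := hq₀ (ZMod p) (by rw [ZMod.card]; exact (le_max_left _ _).trans hp)
  have h2 := one_sub_le_errorProb (C (ZMod p)) A S s hs hsK hT
  have h3 : (C (ZMod p)).errorProb A ≤ (C (ZMod p)).worstErrorProb :=
    Finite.le_ciSup (fun A => (C (ZMod p)).errorProb A) A
  have h4 : (2 * (2 ^ K * K + 1) : ℝ) ≤ p := by exact_mod_cast (le_max_right _ _).trans hp
  have hp0 : (0 : ℝ) < p := by exact_mod_cast hprime.pos
  rw [ZMod.card] at h2
  have h5 : (2 ^ K * K + 1 : ℝ) / p ≤ 1 / 2 := by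
    rw [div_le_iff₀ hp0]; linarith
  linarith

/-- An achievable communication cost is at least `Nr * s` when every set of `Nr - 1` workers misses
at least `s` datasets. -/
theorem mul_le_of_isAchievable {K N Nr Kc M : ℕ} {R : ℝ} (hNrN : Nr ≤ N)
    (hR : IsAchievable K N Nr Kc M R) (s : ℕ) (hs : s ≤ Kc) (hsK : s + (Nr - 1) * M ≤ K) :
    (Nr : ℝ) * s ≤ R := by
  obtain ⟨L, T, C, hL, rfl, hC⟩ := hR
  obtain ⟨A, -, hA⟩ := Finset.exists_subset_card_eq
    (s := (Finset.univ : Finset (Fin N))) (n := Nr) (by simpa using hNrN)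
  have h : ∀ n ∈ A, s * L ≤ T n := fun n hn => by
    have := cutset_bound C hC ⟨A, hA⟩ {n} s hs (by
      rwa [Finset.sdiff_singleton_eq_erase, Finset.card_erase_of_mem hn, hA])
    simpa using this
  have hL0 : (0 : ℝ) < L := by exact_mod_cast hL
  refine le_trans ?_ (Finite.le_ciSup (fun A : {A : Finset (Fin N) // A.card = Nr} =>
    (∑ n ∈ A.1, (T n : ℝ)) / (L : ℝ)) ⟨A, hA⟩)
  rw [le_div_iff₀ hL0]
  have h2 : ∑ _n ∈ A, s * L ≤ ∑ n ∈ A, T n := Finset.sum_le_sum h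
  rw [Finset.sum_const, hA, smul_eq_mul] at h2
  calc (Nr : ℝ) * s * L = ((Nr * (s * L) : ℕ) : ℝ) := by push_cast; ring
    _ ≤ _ := by exact_mod_cast h2

/-- The cut-set bound with `S = A`: no other worker responds, so `s = Kc` is allowed. -/
theorem le_of_isAchievable {K N Nr Kc M : ℕ} {R : ℝ} (hNrN : Nr ≤ N) (hKcK : Kc ≤ K)
    (hR : IsAchievable K N Nr Kc M R) : (Kc : ℝ) ≤ R := by
  obtain ⟨L, T, C, hL, rfl, hC⟩ := hR
  obtain ⟨A, -, hA⟩ := Finset.exists_subset_card_eq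
    (s := (Finset.univ : Finset (Fin N))) (n := Nr) (by simpa using hNrN)
  have h := cutset_bound C hC ⟨A, hA⟩ A Kc le_rfl (by simpa using hKcK)
  have hL0 : (0 : ℝ) < L := by exact_mod_cast hL
  refine le_trans ?_ (Finite.le_ciSup (fun A : {A : Finset (Fin N) // A.card = Nr} =>
    (∑ n ∈ A.1, (T n : ℝ)) / (L : ℝ)) ⟨A, hA⟩)
  rw [le_div_iff₀ hL0]
  exact_mod_cast h

end DistSepComp

/-! ### From computable request matrices to schemes -/

namespace DistSepComp

/-- For the request matrix `G`, some assignment and encoding functions with answer lengths `T`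
determine `G * W` from the answers of any `Nr` workers. -/
def Computable {F : Type} [Field F] {K N Kc : ℕ} (Nr M L : ℕ) (T : Fin N → ℕ)
    (G : Matrix (Fin Kc) (Fin K) F) : Prop :=
  ∃ Z : Fin N → Finset (Fin K), (∀ n, (Z n).card ≤ M) ∧
    ∃ e : (n : Fin N) → (↥(Z n) → Fin L → F) → (Fin (T n) → F),
      ∀ A : Finset (Fin N), A.card = Nr → ∀ W W' : Matrix (Fin K) (Fin L) F,
        (∀ n ∈ A, e n (fun k => W k.1) = e n (fun k => W' k.1)) → G * W = G * W'

open Classical in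
/-- A scheme that makes no error whenever the request matrix is computable. -/
theorem exists_scheme (F : Type) [Field F] (K N Nr Kc M L : ℕ) (T : Fin N → ℕ) :
    ∃ C : Scheme F K N Nr Kc M L T, ∀ G, Computable Nr M L T G → ∀ W A,
      C.output G W A = G * W := by
  have h : ∀ G : Matrix (Fin Kc) (Fin K) F, ∃ Z : Fin N → Finset (Fin K),
      (∀ n, (Z n).card ≤ M) ∧ ∃ e : (n : Fin N) → (↥(Z n) → Fin L → F) → (Fin (T n) → F),
      Computable Nr M L T G → ∀ A : Finset (Fin N), A.card = Nr →
        ∀ W W' : Matrix (Fin K) (Fin L) F,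
        (∀ n ∈ A, e n (fun k => W k.1) = e n (fun k => W' k.1)) → G * W = G * W' := by
    intro G
    by_cases hG : Computable Nr M L T G
    · obtain ⟨Z, hZ, e, he⟩ := hG
      exact ⟨Z, hZ, e, fun _ => he⟩
    · exact ⟨fun _ => ∅, by simp, fun _ _ => 0, fun h => absurd h hG⟩
  choose Z hZ e he using h
  -- The decoder picks any message matrix consistent with the answers; computability makes the
  -- product independent of the choice.
  refine ⟨⟨Z, hZ, e, fun G A X =>
    if hX : ∃ W : Matrix (Fin K) (Fin L) F, ∀ n : ↥A.1, e G n.1 (fun k => W k.1) = X n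
    then G * hX.choose else 0⟩, ?_⟩
  intro G hG W A
  have hX : ∃ W' : Matrix (Fin K) (Fin L) F, ∀ n : ↥A.1,
      e G n.1 (fun k => W' k.1) = e G n.1 (fun k => W k.1) := ⟨W, fun _ => rfl⟩
  refine (dif_pos hX).trans ?_
  exact he G hG A.1 A.2 _ _ fun n hn => hX.choose_spec ⟨n, hn⟩

theorem commCost_const {N Nr : ℕ} (hNrN : Nr ≤ N) (L t : ℕ) :
    commCost Nr L (fun _ : Fin N => t) = (Nr : ℝ) * t / L := by
  obtain ⟨A, -, hA⟩ := Finset.exists_subset_card_eq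
    (s := (Finset.univ : Finset (Fin N))) (n := Nr) (by simpa using hNrN)
  have : Nonempty {A : Finset (Fin N) // A.card = Nr} := ⟨⟨A, hA⟩⟩
  unfold commCost
  have h : ∀ A : {A : Finset (Fin N) // A.card = Nr},
      (∑ _n ∈ A.1, (t : ℝ)) / (L : ℝ) = (Nr : ℝ) * t / L := fun A => by
    rw [Finset.sum_const, A.2, nsmul_eq_mul]
  simp only [h, ciSup_const]

open Classical in
/-- If almost all request matrices are computable with `t` symbols per worker, then the
communication cost `Nr * t / L` is achievable. -/
theorem isAchievable_of_computable {K N Nr Kc M L t : ℕ} (hNrN : Nr ≤ N) (hL : 1 ≤ L) (c q₁ : ℕ)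
    (h : ∀ (F : Type) [Field F] [Fintype F], q₁ ≤ Fintype.card F →
      (Finset.univ.filter fun G : Matrix (Fin Kc) (Fin K) F =>
        ¬ Computable Nr M L (fun _ : Fin N => t) G).card * Fintype.card F
        ≤ c * Fintype.card F ^ (Kc * K)) :
    IsAchievable K N Nr Kc M ((Nr : ℝ) * t / L) := by
  refine ⟨L, fun _ => t, fun F _ _ => (exists_scheme F K N Nr Kc M L _).choose, hL,
    commCost_const hNrN L t, fun δ hδ => ?_⟩
  obtain ⟨q₂, hq₂⟩ := exists_nat_gt (c / δ)
  refine ⟨max q₁ q₂, fun F _ _ hF => ?_⟩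
  have hC := (exists_scheme F K N Nr Kc M L (fun _ => t)).choose_spec
  set C := (exists_scheme F K N Nr Kc M L (fun _ => t)).choose
  obtain ⟨A, -, hA⟩ := Finset.exists_subset_card_eq
    (s := (Finset.univ : Finset (Fin N))) (n := Nr) (by simpa using hNrN)
  have : Nonempty {A : Finset (Fin N) // A.card = Nr} := ⟨⟨A, hA⟩⟩
  obtain ⟨B, hB⟩ := exists_eq_ciSup_of_finite
    (f := fun A : {A : Finset (Fin N) // A.card = Nr} => C.errorProb A)
  unfold Scheme.worstErrorProb
  rw [← hB]
  have hbad := h F ((le_max_left _ _).trans hF)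
  set Bad := Finset.univ.filter fun G : Matrix (Fin Kc) (Fin K) F =>
    ¬ Computable Nr M L (fun _ : Fin N => t) G with hBad
  unfold Scheme.errorProb
  rw [Fintype.card_prod, card_matrix_fin, card_matrix_fin]
  -- Errors occur only over non-computable request matrices, a proportion at most `c / q < δ`.
  have hle : (Finset.univ.filter
      (fun p : Matrix (Fin Kc) (Fin K) F × Matrix (Fin K) (Fin L) F =>
        C.output p.1 p.2 B ≠ p.1 * p.2)).card ≤ Bad.card * Fintype.card F ^ (K * L) := by
    rw [← card_matrix_fin, ← Finset.card_univ, ← Finset.card_product]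
    refine Finset.card_le_card fun p hp => ?_
    have hp' := (Finset.mem_filter.1 hp).2
    refine Finset.mem_product.2 ⟨Finset.mem_filter.2 ⟨Finset.mem_univ _, fun hG => ?_⟩,
      Finset.mem_univ _⟩
    exact hp' (hC p.1 hG p.2 B)
  have hq0 : 0 < Fintype.card F := Fintype.card_pos
  set q := Fintype.card F
  have hq0' : (0 : ℝ) < q := by exact_mod_cast hq0
  have hqδ : (c : ℝ) < δ * q := by
    have h1 : (q₂ : ℝ) ≤ q := by exact_mod_cast (le_max_right _ _).trans hF
    have h2 : (c : ℝ) / δ < q := hq₂.trans_le h1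
    rw [div_lt_iff₀ hδ] at h2
    linarith
  have hXK : (0 : ℝ) < (q : ℝ) ^ (Kc * K) := by positivity
  have hXL : (0 : ℝ) < (q : ℝ) ^ (K * L) := by positivity
  have hbad' : (Bad.card : ℝ) * q ≤ c * (q : ℝ) ^ (Kc * K) := by exact_mod_cast hbad
  have hBadlt : (Bad.card : ℝ) < δ * (q : ℝ) ^ (Kc * K) := by
    have : (Bad.card : ℝ) * q < δ * (q : ℝ) ^ (Kc * K) * q :=
      hbad'.trans_lt (by nlinarith)
    exact lt_of_mul_lt_mul_right this hq0'.le
  push_cast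
  rw [div_lt_iff₀ (by positivity)]
  calc _ ≤ (Bad.card : ℝ) * (q : ℝ) ^ (K * L) := by exact_mod_cast hle
    _ < δ * (q : ℝ) ^ (Kc * K) * (q : ℝ) ^ (K * L) := mul_lt_mul_of_pos_right hBadlt hXL
    _ = _ := by ring

theorem isAchievable_of_forall_computable {K N Nr Kc M L t : ℕ} (hNrN : Nr ≤ N) (hL : 1 ≤ L)
    (q₁ : ℕ) (h : ∀ (F : Type) [Field F] [Fintype F], q₁ ≤ Fintype.card F →
      ∀ G : Matrix (Fin Kc) (Fin K) F, Computable Nr M L (fun _ : Fin N => t) G) :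
    IsAchievable K N Nr Kc M ((Nr : ℝ) * t / L) := by
  classical
  refine isAchievable_of_computable hNrN hL 0 q₁ fun F _ _ hF => ?_
  rw [Finset.filter_false_of_mem fun G _ => not_not.2 (h F hF G)]
  simp

/-- The datasets split evenly into `N` groups. -/
theorem exists_groups (N m : ℕ) :
    ∃ g : Fin (N * m) → Fin N, ∀ n, (Finset.univ.filter fun k => g k = n).card = m := by
  refine ⟨fun k => (finProdFinEquiv.symm k).1, fun n => ?_⟩
  have : (Finset.univ.filter fun k : Fin (N * m) => (finProdFinEquiv.symm k).1 = n) =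
      (Finset.univ : Finset (Fin m)).map
        ⟨fun j => finProdFinEquiv (n, j), fun a b h => by simpa using h⟩ := by
    ext k
    simp only [Finset.mem_filter, Finset.mem_univ, true_and, Finset.mem_map]
    constructor
    · rintro rfl
      exact ⟨(finProdFinEquiv.symm k).2, finProdFinEquiv.apply_symm_apply k⟩
    · rintro ⟨j, rfl⟩
      exact congrArg Prod.fst (finProdFinEquiv.symm_apply_apply (n, j))
  rw [this, Finset.card_map, Finset.card_univ, Fintype.card_fin]

/-! ### Explicit encodings -/

section Encodings

variable {F : Type} [Field F] {K N Kc : ℕ}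

/-- Every worker holds all datasets. -/
theorem computable_one {M : ℕ} (hM : K ≤ M) (G : Matrix (Fin Kc) (Fin K) F) :
    Computable 1 M 1 (fun _ : Fin N => Kc) G := by
  refine ⟨fun _ => Finset.univ, fun _ => by simpa using hM,
    fun n X i => ∑ k, G i k * X ⟨k, Finset.mem_univ k⟩ 0, ?_⟩
  intro A hA W W' h
  obtain ⟨n, rfl⟩ := Finset.card_eq_one.1 hA
  have := h n (Finset.mem_singleton_self n)
  ext i l
  rw [Subsingleton.elim l 0]
  exact congrFun this i

/-- Every worker combines the messages of its own group as requested. -/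
theorem computable_coded_groups {M : ℕ} (g : Fin K → Fin N)
    (hg : ∀ n, (Finset.univ.filter fun k => g k = n).card ≤ M)
    (G : Matrix (Fin Kc) (Fin K) F) : Computable N M 1 (fun _ : Fin N => Kc) G := by
  refine ⟨fun n => Finset.univ.filter fun k => g k = n, hg, fun n X i => ∑ k, G i k.1 * X k 0, ?_⟩
  intro A hA W W' h
  have hAu : A = Finset.univ := (Finset.card_eq_iff_eq_univ A).1 (by simpa using hA)
  subst hAu
  have key : ∀ (W : Matrix (Fin K) (Fin 1) F) i, (G * W) i 0 =
      ∑ n, ∑ k : ↥(Finset.univ.filter fun k => g k = n), G i k.1 * W k.1 0 := by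
    intro W i
    rw [Matrix.mul_apply, ← Finset.sum_fiberwise _ g]
    refine Finset.sum_congr rfl fun n _ => ?_
    exact (Finset.sum_coe_sort _ fun k => G i k * W k 0).symm
  ext i l
  rw [Subsingleton.elim l 0, key, key]
  exact Finset.sum_congr rfl fun n _ => congrFun (h n (Finset.mem_univ n)) i

/-- Every worker sends the messages of its own group. -/
theorem computable_uncoded_groups {m : ℕ} (g : Fin K → Fin N)
    (hg : ∀ n, (Finset.univ.filter fun k => g k = n).card = m)
    (G : Matrix (Fin Kc) (Fin K) F) : Computable N m 1 (fun _ : Fin N => m) G := by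
  refine ⟨fun n => Finset.univ.filter fun k => g k = n, fun n => (hg n).le,
    fun n X j => X ((Finset.equivFinOfCardEq (hg n)).symm j) 0, ?_⟩
  intro A hA W W' h
  have hAu : A = Finset.univ := (Finset.card_eq_iff_eq_univ A).1 (by simpa using hA)
  subst hAu
  congr 1
  ext k l
  rw [Subsingleton.elim l 0]
  simpa using congrFun (h (g k) (Finset.mem_univ _))
    (Finset.equivFinOfCardEq (hg (g k)) ⟨k, by simp⟩)

/-- Worker `n` combines the contributions of the groups `i` with weights `α i - α n`. -/
theorem computable_two_weighted {M : ℕ} (g : Fin K → Fin N)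
    (hg : ∀ n, (Finset.univ.filter fun k => g k ≠ n).card ≤ M) (α : Fin N → F)
    (hα : Function.Injective α) (G : Matrix (Fin Kc) (Fin K) F) :
    Computable 2 M 1 (fun _ : Fin N => Kc) G := by
  refine ⟨fun n => Finset.univ.filter fun k => g k ≠ n, hg,
    fun n X i => ∑ k, G i k.1 * ((α (g k.1) - α n) * X k 0), ?_⟩
  intro A hA W W' h
  obtain ⟨a, b, hab, rfl⟩ := Finset.card_eq_two.1 hA
  -- The weight of the missing group is `α n - α n = 0`, so the answer equals a sum over all
  -- datasets. Subtracting two such sums leaves `(α b - α a)` times the request.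
  have key : ∀ (W : Matrix (Fin K) (Fin 1) F) i n,
      ∑ k : ↥(Finset.univ.filter fun k => g k ≠ n), G i k.1 * ((α (g k.1) - α n) * W k.1 0) =
      ∑ k, G i k * ((α (g k) - α n) * W k 0) := by
    intro W i n
    rw [Finset.sum_coe_sort (Finset.univ.filter fun k => g k ≠ n)
      fun k => G i k * ((α (g k) - α n) * W k 0), Finset.sum_filter_of_ne]
    rintro k - hk rfl
    simp at hk
  have hne : α b - α a ≠ 0 := sub_ne_zero.2 fun h => hab (hα h).symm
  have key2 : ∀ (W : Matrix (Fin K) (Fin 1) F) i, (α b - α a) * (G * W) i 0 =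
      ∑ k, G i k * ((α (g k) - α a) * W k 0) - ∑ k, G i k * ((α (g k) - α b) * W k 0) := by
    intro W i
    rw [Matrix.mul_apply, Finset.mul_sum, ← Finset.sum_sub_distrib]
    exact Finset.sum_congr rfl fun k _ => by ring
  ext i l
  rw [Subsingleton.elim l 0]
  refine mul_left_cancel₀ hne ?_
  have ha := congrFun (h a (by simp)) i
  have hb := congrFun (h b (by simp)) i
  simp only [key] at ha hb
  rw [key2, key2, ha, hb]

open Module in
/-- Worker `n` projects the extended request along a subspace containing the contribution of the
group that it does not hold; these subspaces are pairwise complementary. -/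
theorem computable_two_projection [Fintype F] {M m d : ℕ} (g : Fin K → Fin N)
    (hg : ∀ n, (Finset.univ.filter fun k => g k ≠ n).card ≤ M)
    (hg' : ∀ n, (Finset.univ.filter fun k => g k = n).card = m) (hmd : 2 * m ≤ d)
    (hN : N < Fintype.card F) (G : Matrix (Fin d) (Fin K) F) (hG : Generic G) :
    Computable 2 M 2 (fun _ : Fin N => d) G := by
  classical
  set B : Fin N → Finset (Fin K) := fun n => Finset.univ.filter fun k => g k = n with hB
  let ext : ∀ D : Finset (Fin K), (↥D → Fin 2 → F) →ₗ[F] Matrix (Fin K) (Fin 2) F := fun D =>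
    { toFun := fun X => Matrix.of fun k l => if hk : k ∈ D then X ⟨k, hk⟩ l else 0
      map_add' := fun X Y => by
        ext k l
        by_cases hk : k ∈ D <;> simp [hk]
      map_smul' := fun c X => by
        ext k l
        by_cases hk : k ∈ D <;> simp [hk] }
  let mulG : Matrix (Fin K) (Fin 2) F →ₗ[F] Matrix (Fin d) (Fin 2) F :=
    { toFun := fun W => G * W
      map_add' := fun _ _ => Matrix.mul_add _ _ _
      map_smul' := fun _ _ => Matrix.mul_smul _ _ _ }
  let P : Fin N → Submodule F (Matrix (Fin d) (Fin 2) F) := fun n =>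
    LinearMap.range (mulG ∘ₗ ext (B n))
  have hext0 : ∀ D X k, k ∉ D → ext D X k = 0 := fun D X k hk => by
    funext l
    exact dif_neg hk
  obtain ⟨Q, hPQ, hQ, hQd⟩ := exists_pairwise_disjoint_finrank_eq d
    (by simp [finrank_matrix, mul_comm]) (by simpa using hN) P
    (by
      intro a b hab
      rw [Submodule.disjoint_def]
      rintro _ ⟨X, rfl⟩ ⟨Y, hY⟩
      have hY' : G * ext (B b) Y = G * ext (B a) X := hY
      have hzero : ∀ k, ext (B a) X k = ext (B b) Y k := by
        intro k
        funext l
        -- Two groups have at most `2 * m ≤ d` datasets, so genericity separates their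
        -- contributions.
        have := hG (fun k => ext (B a) X k l - ext (B b) Y k l) (B a ∪ B b)
          ((Finset.card_union_le _ _).trans (by rw [hg', hg']; omega))
          (fun j hj => by
            rw [Finset.mem_union, not_or] at hj
            rw [hext0 _ _ _ hj.1, hext0 _ _ _ hj.2]
            simp)
          (by
            funext i
            have := congrFun (congrFun hY' i) l
            simp only [Matrix.mul_apply] at this
            simp only [Matrix.mulVec, dotProduct, mul_sub, Finset.sum_sub_distrib, this, sub_self,
              Pi.zero_apply])
        exact sub_eq_zero.1 (congrFun this k)
      have hX0 : ext (B a) X = 0 := by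
        funext k
        by_cases hk : k ∈ B a
        · rw [hzero k]
          refine hext0 _ _ _ fun hk' => hab ?_
          exact ((Finset.mem_filter.1 hk).2).symm.trans (Finset.mem_filter.1 hk').2
        · exact hext0 _ _ _ hk
      change mulG (ext (B a) X) = 0
      rw [hX0, map_zero])
    (fun n => by
      refine (LinearMap.finrank_range_le _).trans ?_
      rw [finrank_pi_fintype]
      simp only [finrank_fin_fun, Finset.sum_const, Finset.card_univ, Fintype.card_coe, hg',
        smul_eq_mul, hB]
      omega)
  -- The quotient has dimension `2 * d - d`, so a class is sent with `d` symbols.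
  have hquot : ∀ n, finrank F (Matrix (Fin d) (Fin 2) F ⧸ Q n) = finrank F (Fin d → F) := by
    intro n
    have h1 := Submodule.finrank_quotient_add_finrank (Q n)
    rw [hQd, finrank_matrix] at h1
    simp at h1 ⊢
    omega
  let E : ∀ n, (Matrix (Fin d) (Fin 2) F ⧸ Q n) ≃ₗ[F] (Fin d → F) := fun n =>
    LinearEquiv.ofFinrankEq _ _ (hquot n)
  -- The part of the request that worker `n` cannot compute comes from group `n`, so it vanishes
  -- modulo `Q n`.
  have hsplit : ∀ n (W : Matrix (Fin K) (Fin 2) F),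
      G * W - G * ext (Finset.univ.filter fun k => g k ≠ n) (fun k => W k.1) ∈ Q n := by
    intro n W
    refine hPQ n ⟨fun k => W k.1, ?_⟩
    rw [← Matrix.mul_sub]
    refine congrArg mulG ?_
    ext k l
    by_cases hk : g k = n
    · have h1 : ext (B n) (fun k => W k.1) k l = W k l := dif_pos (by simp [hB, hk])
      have h2 := congrFun (hext0 (Finset.univ.filter fun k => g k ≠ n) (fun k => W k.1) k
        (by simp [hk])) l
      rw [Matrix.sub_apply, h1, h2]
      simp
    · have h1 : ext (Finset.univ.filter fun k => g k ≠ n) (fun k => W k.1) k l = W k l :=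
        dif_pos (by simp [hk])
      have h2 := congrFun (hext0 (B n) (fun k => W k.1) k (by simp [hB, hk])) l
      rw [Matrix.sub_apply, h1, h2]
      simp
  refine ⟨fun n => Finset.univ.filter fun k => g k ≠ n, hg,
    fun n X => E n ((Q n).mkQ (G * ext _ X)), ?_⟩
  intro A hA W W' h
  obtain ⟨a, b, hab, rfl⟩ := Finset.card_eq_two.1 hA
  have hmem : ∀ n ∈ ({a, b} : Finset (Fin N)), G * W - G * W' ∈ Q n := by
    intro n hn
    have h1 := (Submodule.Quotient.eq (Q n)).1 ((E n).injective (h n hn))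
    have h2 := hsplit n W
    have h3 := hsplit n W'
    have := sub_mem (add_mem h2 h1) h3
    convert this using 1
    abel
  exact sub_eq_zero.1 (Submodule.disjoint_def.1 (hQ hab) _ (hmem a (by simp)) (hmem b (by simp)))

/-- A scheme for more requests serves fewer requests. -/
theorem Computable.of_submatrix {Nr M L d : ℕ} {T : Fin N → ℕ} {G : Matrix (Fin d) (Fin K) F}
    (h : Computable Nr M L T G) (f : Fin Kc → Fin d) :
    Computable Nr M L T (G.submatrix f id) := by
  obtain ⟨Z, hZ, e, he⟩ := h
  refine ⟨Z, hZ, e, fun A hA W W' hW => ?_⟩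
  have := he A hA W W' hW
  ext i l
  exact congrFun (congrFun this (f i)) l

open Classical in
/-- If almost all matrices with `Kc + r` rows are computable, so are almost all matrices with
`Kc` rows. -/
theorem card_not_computable_le [Fintype F] {Nr M L r c : ℕ} {T : Fin N → ℕ}
    (h : (Finset.univ.filter fun G : Matrix (Fin (Kc + r)) (Fin K) F =>
      ¬ Computable Nr M L T G).card * Fintype.card F ≤ c * Fintype.card F ^ ((Kc + r) * K)) :
    (Finset.univ.filter fun G : Matrix (Fin Kc) (Fin K) F =>
      ¬ Computable Nr M L T G).card * Fintype.card F ≤ c * Fintype.card F ^ (Kc * K) := by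
  -- All `q ^ (r * K)` extensions of a non-computable matrix by `r` rows are non-computable.
  have hle : (Finset.univ.filter fun G : Matrix (Fin Kc) (Fin K) F =>
      ¬ Computable Nr M L T G).card * Fintype.card F ^ (r * K) ≤
      (Finset.univ.filter fun G : Matrix (Fin (Kc + r)) (Fin K) F =>
      ¬ Computable Nr M L T G).card := by
    rw [← card_matrix_fin, ← Finset.card_univ, ← Finset.card_product]
    refine Finset.card_le_card_of_injOn
      (fun p : Matrix (Fin Kc) (Fin K) F × Matrix (Fin r) (Fin K) F =>
        (Fin.append p.1 p.2 : Matrix (Fin (Kc + r)) (Fin K) F)) ?_ ?_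
    · intro p hp
      have hp' := (Finset.mem_filter.1 (Finset.mem_product.1 hp).1).2
      refine Finset.mem_coe.2 (Finset.mem_filter.2 ⟨Finset.mem_univ _, fun hG => hp' ?_⟩)
      convert hG.of_submatrix (Fin.castAdd r) using 1
      ext i j
      exact (congrFun (Fin.append_left p.1 p.2 i) j).symm
    · rintro ⟨G, E⟩ - ⟨G', E'⟩ - hGE
      simp only at hGE
      refine Prod.ext ?_ ?_
      · funext i
        exact (Fin.append_left G E i).symm.trans
          ((congrFun hGE (Fin.castAdd r i)).trans (Fin.append_left G' E' i))
      · funext i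
        exact (Fin.append_right G E i).symm.trans
          ((congrFun hGE (Fin.natAdd Kc i)).trans (Fin.append_right G' E' i))
  have hq0 : 0 < Fintype.card F ^ (r * K) := by have := Fintype.card_pos (α := F); positivity
  refine le_of_mul_le_mul_right ?_ hq0
  calc _ = (Finset.univ.filter fun G : Matrix (Fin Kc) (Fin K) F =>
      ¬ Computable Nr M L T G).card * Fintype.card F ^ (r * K) * Fintype.card F := by ring
    _ ≤ _ := Nat.mul_le_mul_right _ hle
    _ ≤ _ := h
    _ = _ := by rw [add_mul, pow_add]; ring

end Encodings

/-! ### Matching the bounds in each case -/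

theorem card_filter_ne {N m : ℕ} {g : Fin (N * m) → Fin N}
    (hg : ∀ n, (Finset.univ.filter fun k => g k = n).card = m) (n : Fin N) :
    (Finset.univ.filter fun k => g k ≠ n).card = m * (N - 1) := by
  have h := Finset.card_filter_add_card_filter_not (s := (Finset.univ : Finset (Fin (N * m))))
    (fun k => g k = n)
  rw [hg, Finset.card_univ, Fintype.card_fin] at h
  have : N * m = m * (N - 1) + m := by
    obtain ⟨N', rfl⟩ : ∃ N', N = N' + 1 := ⟨N - 1, by have := n.2; omega⟩
    rw [Nat.add_sub_cancel]; ring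
  have h2 : (Finset.univ.filter fun k => g k ≠ n).card =
    (Finset.univ.filter fun k => ¬ g k = n).card := rfl
  omega

/-- Two responding workers achieve any communication cost `d ≥ Kc` with `2 * m ≤ d`. -/
theorem isAchievable_two {N m Kc d : ℕ} (hN : 2 ≤ N) (hd : Kc ≤ d) (hmd : 2 * m ≤ d) :
    IsAchievable (N * m) N 2 Kc (m * (N - 1)) (d : ℝ) := by
  classical
  obtain ⟨g, hg⟩ := exists_groups N m
  obtain ⟨r, rfl⟩ : ∃ r, d = Kc + r := ⟨d - Kc, by omega⟩
  have h := isAchievable_of_computable (K := N * m) (Kc := Kc) (M := m * (N - 1)) (L := 2)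
    (t := Kc + r) hN one_le_two (2 ^ (N * m) * (N * m)) (N + 1) (fun F _ _ hF => by
      refine card_not_computable_le (le_trans (Nat.mul_le_mul_right _ (Finset.card_le_card ?_))
        (card_not_generic_mul_le F (Kc + r) (N * m)))
      intro G hG
      refine Finset.mem_filter.2 ⟨Finset.mem_univ _, fun hgen => (Finset.mem_filter.1 hG).2 ?_⟩
      exact computable_two_projection g (fun n => (card_filter_ne hg n).le) hg hmd hF G hgen)
  convert h using 1
  push_cast
  ring

end DistSepComp

theorem corollary2 (K N Nr Kc M : ℕ) (hN : 1 ≤ N) (hNK : N ∣ K)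
    (hNr : 1 ≤ Nr) (hNrN : Nr ≤ N) (hKc : 1 ≤ Kc) (hKcK : Kc ≤ K)
    (hM : M = K / N * (N - Nr + 1)) :
    (Nr = 1 → DistSepComp.IsMinCommCost K N Nr Kc M (Kc : ℝ)) ∧
    (Nr = 2 →
      (Kc ≤ K / N → DistSepComp.IsMinCommCost K N Nr Kc M (2 * (Kc : ℝ))) ∧
      (K / N < Kc → Kc ≤ 2 * (K / N) →
        DistSepComp.IsMinCommCost K N Nr Kc M (2 * ((K : ℝ) / (N : ℝ)))) ∧
      (2 * (K / N) < Kc → DistSepComp.IsMinCommCost K N Nr Kc M (Kc : ℝ))) ∧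
    (Nr = N →
      (Kc ≤ K / N → DistSepComp.IsMinCommCost K N Nr Kc M ((N : ℝ) * (Kc : ℝ))) ∧
      (K / N < Kc → DistSepComp.IsMinCommCost K N Nr Kc M (K : ℝ))) := by
  open DistSepComp in
  obtain ⟨m, rfl⟩ := hNK
  rw [Nat.mul_div_cancel_left m (by omega)] at hM ⊢
  obtain ⟨g, hg⟩ := exists_groups N m
  refine ⟨?_, ?_, ?_⟩
  · rintro rfl
    have hM' : M = N * m := by rw [hM, Nat.sub_add_cancel hN, mul_comm]
    refine ⟨?_, fun R hR => le_of_isAchievable hNrN hKcK hR⟩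
    simpa using isAchievable_of_forall_computable hNrN le_rfl 0
      fun F _ _ _ G => computable_one hM'.ge G
  · rintro rfl
    have hM' : M = m * (N - 1) := by rw [hM]; congr 1; omega
    subst hM'
    -- One worker leaves at least `m` datasets unseen, so the cut-set bound applies for every `s ≤
    -- min Kc m`.
    have hsum : m + m * (N - 1) = N * m := by
      obtain ⟨N', rfl⟩ : ∃ N', N = N' + 1 := ⟨N - 1, by omega⟩
      rw [Nat.add_sub_cancel]; ring
    refine ⟨fun hle => ⟨?_, fun R hR => ?_⟩, fun hlt hle => ⟨?_, fun R hR => ?_⟩,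
      fun hlt => ⟨isAchievable_two hNrN le_rfl hlt.le,
        fun R hR => le_of_isAchievable hNrN hKcK hR⟩⟩
    · have h := isAchievable_of_forall_computable (Kc := Kc) hNrN le_rfl N
        fun F _ _ hF G => by
          obtain ⟨α⟩ : Nonempty (Fin N ↪ F) :=
            Function.Embedding.nonempty_of_card_le (by simpa using hF)
          exact computable_two_weighted g (fun n => (card_filter_ne hg n).le) α α.injective G
      simpa using h
    · simpa using mul_le_of_isAchievable hNrN hR Kc le_rfl (by simp; omega)
    -- The request is padded to `d = 2 * m` rows.
    · have h := isAchievable_two (m := m) hNrN hle le_rfl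
      have hN0 : (N : ℝ) ≠ 0 := by positivity
      push_cast at h ⊢
      rwa [mul_div_cancel_left₀ _ hN0]
    · have hN0 : (N : ℝ) ≠ 0 := by positivity
      push_cast
      rw [mul_div_cancel_left₀ _ hN0]
      simpa using mul_le_of_isAchievable hNrN hR m hlt.le (by simp; omega)
  · rintro rfl
    have hM' : M = m := by rw [hM]; simp
    subst hM'
    have hsum : M + (Nr - 1) * M = Nr * M := by
      obtain ⟨N', rfl⟩ : ∃ N', Nr = N' + 1 := ⟨Nr - 1, by omega⟩
      rw [Nat.add_sub_cancel]; ring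
    refine ⟨fun hle => ⟨?_, fun R hR => ?_⟩, fun hlt => ⟨?_, fun R hR => ?_⟩⟩
    · simpa using isAchievable_of_forall_computable le_rfl le_rfl 0
        fun F _ _ _ G => computable_coded_groups g (fun n => (hg n).le) G
    · exact mul_le_of_isAchievable le_rfl hR Kc le_rfl (by omega)
    · simpa using isAchievable_of_forall_computable le_rfl le_rfl 0
        fun F _ _ _ G => computable_uncoded_groups g hg G
    · simpa using mul_le_of_isAchievable le_rfl hR M hlt.le (by omega)
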